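/- Consider a single-commodity buffered network: a finite acyclic directed graph $(\mathcal V,\mathcal E)$ with $\mathcal V=\{1,\dots,N\}$, buffer sizes $b_i\in[0,\infty]$, link capacities $c_{ij}\ge 0$, maximum departure rates $\mu_i\ge 0$ and constant packet injection rates $\lambda_i\ge 0$. Write $I_i=\{x\in\mathbb R: 0\le x\le b_i\}$ for the feasible queue lengths at node $i$ and $\mathcal Q=I_1\times\dots\times I_N$. A local policy consists of link rates $g_{ij}:I_i\times I_j\to[0,c_{ij}]$ for $(i,j)\in\mathcal E$, differentiable as functions of the pair $(q_i,q_j)$, and departure rates $g_{iT}:I_i\to[0,\mu_i]$, differentiable in $q_i$. The queue dynamics under the policy are $\dot{\mathbf q}=\mathbf f(\mathbf q)$, $\mathbf q\in\mathcal Q$, with $$f_i(\mathbf q)=\lambda_i+\sum_{k:(k,i)\in\mathcal E}g_{ki}(q_k,q_i)-\sum_{j:(i,j)\in\mathcal E}g_{ij}(q_i,q_j)-g_{iT}(q_i),\qquad i=1,\dots,N,$$ and an equilibrium point is a $\mathbf q^*\in\mathcal Q$ with $\mathbf f(\mathbf q^*)=\mathbf 0$. Lemma. Suppose that there are finite values $\underline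 b_i\le\bar b_i$ in $I_i$ $(i=1,\dots,N)$ such that for every node $i$ and all $q_j\in[\underline b_j,\bar b_j]$, $j\ne i$: (i) when $q_i=\bar b_i$, $f_i(\mathbf q)\le 0$; (ii) when $q_i=\underline b_i$, $f_i(\mathbf q)\ge 0$. Then the system $\dot{\mathbf q}=\mathbf f(\mathbf q)$ has an equilibrium point in the box $\bar{\mathcal B}=\times_{i=1}^N[\underline b_i,\bar b_i]$. -/

import Mathlib

open scoped NNReal ENNReal

/-- A single-commodity buffered communication network: an acyclic directed graph on the node set `V`
with link capacities `capacity i j`, maximum departure rates `maxDeparture i` towards the meta destination,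
(constant) packet injection rates `injection i`, and buffer sizes `buffer i`, where `∞` is an
unbounded buffer. -/
structure BufferedNetwork (V : Type*) where
  graph : Digraph V
  acyclic : ∀ v, ¬ Relation.TransGen graph.Adj v v
  capacity : V → V → ℝ≥0
  maxDeparture : V → ℝ≥0
  injection : V → ℝ≥0
  buffer : V → ℝ≥0∞

namespace BufferedNetwork

variable {V : Type*}

/-- The feasible queue lengths `[0, buffer i]` at node `i` (all of `[0, ∞)` for an unbounded buffer). -/
def queueRange (N : BufferedNetwork V) (i : V) : Set ℝ :=
  {x | 0 ≤ x ∧ ENNReal.ofReal x ≤ N.buffer i}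

/-- The set of feasible queue length vectors, the product of the intervals `[0, buffer i]`. -/
def feasible (N : BufferedNetwork V) : Set (V → ℝ) :=
  {q | ∀ i, q i ∈ N.queueRange i}

/-- A local stationary transmission policy. The rate on a link `(i, j)` is a function
`rate i j (q i) (q j)` of the queue lengths at its two ends, the departure rate at `i` is a function
`departure i (q i)`; they respect the capacities and are differentiable (the link rates as functions
of the pair of queue lengths) on the feasible queue lengths.

The vanishing of a link rate at an empty upstream or a full downstream buffer is not demanded:
smooth policies, such as logistic approximations of backpressure, satisfy it only in the limit. -/
structure LocalPolicy (N : BufferedNetwork V) where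
  rate : V → V → ℝ → ℝ → ℝ
  departure : V → ℝ → ℝ
  rate_mem : ∀ i j, N.graph.Adj i j → ∀ x ∈ N.queueRange i, ∀ y ∈ N.queueRange j,
    rate i j x y ∈ Set.Icc (0 : ℝ) (N.capacity i j)
  departure_mem : ∀ i, ∀ x ∈ N.queueRange i,
    departure i x ∈ Set.Icc (0 : ℝ) (N.maxDeparture i)
  differentiableOn_rate : ∀ i j, N.graph.Adj i j →
    DifferentiableOn ℝ (fun p : ℝ × ℝ => rate i j p.1 p.2) (N.queueRange i ×ˢ N.queueRange j)
  differentiableOn_departure : ∀ i, DifferentiableOn ℝ (departure i) (N.queueRange i)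

open Classical in
/-- The right-hand side `f` of the queue dynamics `dq/dt = f(q)` under a local policy:
injection plus inflow minus outflow minus departure. -/
noncomputable def LocalPolicy.dynamics [Fintype V] {N : BufferedNetwork V} (P : N.LocalPolicy)
    (q : V → ℝ) (i : V) : ℝ :=
  (N.injection i : ℝ)
    + ∑ k : V with N.graph.Adj k i, P.rate k i (q k) (q i)
    - ∑ j : V with N.graph.Adj i j, P.rate i j (q i) (q j)
    - P.departure i (q i)

/-- An equilibrium point of `dq/dt = f(q)`: a feasible queue length vector where `f` vanishes. -/
def LocalPolicy.IsEquilibrium [Fintype V] {N : BufferedNetwork V} (P : N.LocalPolicy)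
    (q : V → ℝ) : Prop :=
  q ∈ N.feasible ∧ P.dynamics q = 0

end BufferedNetwork

/-! A continuous field that points weakly inwards on every face of a box has a zero
(Poincaré–Miranda), and the dynamics are such a field. Poincaré–Miranda is proved with mod 2
cochains. Cut the box into a grid, triangulate each cube by Freudenthal simplices, and label the
vertices by the sign of each component. Sum the cup product of the labels' coboundaries over all
simplices. Replacing one label by another that separates the same two faces adds a coboundary
(`sum_primitive_skip`), whose sum reduces to boundary facets (`sum_sum_skip_eq_zero`) and vanishes
there. Coordinate labels give 1 (`total_stdLabel`), so some simplex contributes, and its cube shows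
both signs of every component (`exists_cube`). Refining the grid, compactness yields the zero. -/

namespace GridCochain

open Finset Equiv

/-- The sequence `v` with its `i`-th entry removed. -/
def skip {X : Type*} (i : ℕ) (v : ℕ → X) : ℕ → X := fun t => if t < i then v t else v (t + 1)

/-- The cup product of the mod 2 coboundaries of `l 0, …, l (k - 1)`. -/
def cup {X : Type*} (l : ℕ → X → ZMod 2) (k : ℕ) (w : ℕ → X) : ZMod 2 :=
  ∏ j ∈ range k, (l j (w (j + 1)) + l j (w j))

/-- The cup product in which the factor `l k` enters without coboundary. -/
def primitive {X : Type*} (l : ℕ → X → ZMod 2) (k r : ℕ) (w : ℕ → X) : ZMod 2 :=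
  cup l k w * l k (w k) *
    ∏ j ∈ range r, (l (k + 1 + j) (w (k + 1 + j)) + l (k + 1 + j) (w (k + j)))

/-! ### Coboundaries of mod 2 cup products -/

section Leibniz

variable {X : Type*} (l : ℕ → X → ZMod 2)

lemma skip_of_lt {i t : ℕ} (v : ℕ → X) (h : t < i) : skip i v t = v t := if_pos h

lemma skip_of_le {i t : ℕ} (v : ℕ → X) (h : i ≤ t) : skip i v t = v (t + 1) :=
  if_neg (not_lt.mpr h)

lemma cup_succ (k : ℕ) (w : ℕ → X) :
    cup l (k + 1) w = cup l k w * (l k (w (k + 1)) + l k (w k)) :=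
  prod_range_succ _ _

lemma primitive_succ (k r : ℕ) (w : ℕ → X) :
    primitive l k (r + 1) w =
      primitive l k r w * (l (k + 1 + r) (w (k + 1 + r)) + l (k + 1 + r) (w (k + r))) := by
  rw [primitive, prod_range_succ, ← mul_assoc]; rfl

lemma cup_congr {k : ℕ} {v w : ℕ → X} (h : ∀ t ≤ k, v t = w t) : cup l k v = cup l k w := by
  refine prod_congr rfl fun j hj => ?_
  have := mem_range.mp hj
  rw [h _ (by omega), h _ (by omega)]

lemma primitive_congr {k r : ℕ} {v w : ℕ → X} (h : ∀ t ≤ k + r, v t = w t) :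
    primitive l k r v = primitive l k r w := by
  unfold primitive
  rw [cup_congr l (v := v) (w := w) fun t ht => h t (by omega), h k (by omega)]
  congr 1
  refine prod_congr rfl fun j hj => ?_
  have := mem_range.mp hj
  rw [h _ (by omega), h _ (by omega)]

/-- A cup product of coboundaries is closed. -/
lemma sum_cup_skip (k : ℕ) (v : ℕ → X) : ∑ i ∈ range (k + 2), cup l k (skip i v) = 0 := by
  induction k with
  | zero => simp [cup]; decide
  | succ k ih =>
    rw [sum_range_succ, sum_range_succ]
    -- Omitting an early vertex leaves the last edge intact, so its factor comes out; the three
    -- last-edge factors that remain cancel mod 2.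
    have h1 : ∀ i ∈ range (k + 1), cup l (k + 1) (skip i v) =
        cup l k (skip i v) * (l k (v (k + 2)) + l k (v (k + 1))) := by
      intro i hi
      have := mem_range.mp hi
      rw [cup_succ, skip_of_le v (by omega), skip_of_le v (by omega)]
    rw [sum_congr rfl h1, ← sum_mul, cup_succ, cup_succ]
    rw [sum_range_succ] at ih
    have h2 : cup l k (skip (k + 2) v) = cup l k (skip (k + 1) v) :=
      cup_congr l fun t ht => by rw [skip_of_lt v (by omega), skip_of_lt v (by omega)]
    rw [h2, eq_neg_of_add_eq_zero_left ih, skip_of_le v (le_refl _), skip_of_lt v (by omega),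
      skip_of_lt v (by omega), skip_of_lt v (by omega), CharTwo.neg_eq]
    linear_combination (cup l k (skip (k + 1) v)) * (l k (v (k + 2)) + l k (v (k + 1)) +
      l k (v k)) * CharTwo.two_eq_zero (R := ZMod 2)

/-- The Leibniz rule: the coboundary of `primitive l k r` is the full cup product. -/
lemma sum_primitive_skip (k r : ℕ) (v : ℕ → X) :
    ∑ i ∈ range (k + r + 2), primitive l k r (skip i v) = cup l (k + r + 1) v := by
  induction r with
  | zero =>
    simp only [primitive, range_zero, prod_empty, mul_one, add_zero]
    rw [sum_range_succ]
    have h1 : ∀ i ∈ range (k + 1), cup l k (skip i v) * l k (skip i v k) =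
        cup l k (skip i v) * l k (v (k + 1)) := by
      intro i hi
      have := mem_range.mp hi
      rw [skip_of_le v (by omega)]
    have h2 : cup l k (skip (k + 1) v) = cup l k v :=
      cup_congr l fun t ht => skip_of_lt v (by omega)
    have ih := sum_cup_skip l k v
    rw [sum_range_succ] at ih
    rw [sum_congr rfl h1, ← sum_mul, eq_neg_of_add_eq_zero_left ih, h2, cup_succ,
      skip_of_lt v (by omega), CharTwo.neg_eq]
    ring
  | succ r ih =>
    rw [show k + (r + 1) + 2 = k + r + 1 + 1 + 1 by ring, sum_range_succ, sum_range_succ]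
    have h1 : ∀ i ∈ range (k + r + 1), primitive l k (r + 1) (skip i v) =
        primitive l k r (skip i v) *
          (l (k + 1 + r) (v (k + r + 2)) + l (k + 1 + r) (v (k + r + 1))) := by
      intro i hi
      have := mem_range.mp hi
      rw [primitive_succ, skip_of_le v (by omega), skip_of_le v (by omega),
        show k + 1 + r + 1 = k + r + 2 by ring]
    rw [sum_congr rfl h1, ← sum_mul, primitive_succ, primitive_succ]
    have h2 : primitive l k r (skip (k + r + 1 + 1) v) = primitive l k r (skip (k + r + 1) v) :=
      primitive_congr l fun t ht => by rw [skip_of_lt v (by omega), skip_of_lt v (by omega)]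
    rw [show k + r + 2 = k + r + 1 + 1 by ring, sum_range_succ] at ih
    rw [h2, show k + (r + 1) + 1 = k + r + 1 + 1 by ring, cup_succ, ← ih,
      skip_of_le v (show k + r + 1 ≤ k + 1 + r by omega), skip_of_lt v (by omega),
      skip_of_lt v (show k + 1 + r < k + r + 1 + 1 by omega), skip_of_lt v (by omega),
      show k + 1 + r + 1 = k + r + 1 + 1 by ring, show k + 1 + r = k + r + 1 by ring]
    linear_combination (primitive l k r (skip (k + r + 1) v)) * l (k + r + 1) (v (k + r)) *
      CharTwo.two_eq_zero (R := ZMod 2)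

end Leibniz

/-! ### Freudenthal triangulation and Stokes -/

/-- The vertices of the simplex of the Freudenthal triangulation with base point `x` that steps
in the directions `π 0, π 1, …`. -/
def vert {n : ℕ} (x : Fin n → ℕ) (π : Perm (Fin n)) (t : ℕ) : Fin n → ℕ :=
  fun j => x j + if (π.symm j : ℕ) < t then 1 else 0

section Stokes

variable {n M : ℕ}

/-- Swapping two consecutive directions moves only the omitted vertex, so interior facets cancel in
pairs. -/
lemma sum_skip_interior (h : (ℕ → Fin n → ℕ) → ZMod 2) (x : Fin n → ℕ) {i : ℕ} (hi : i + 1 < n) :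
    ∑ π : Perm (Fin n), h (skip (i + 1) (vert x π)) = 0 := by
  have hne : (⟨i, by omega⟩ : Fin n) ≠ ⟨i + 1, hi⟩ := by simp
  refine sum_involution (fun π _ => π * swap ⟨i, by omega⟩ ⟨i + 1, hi⟩) ?_ ?_ ?_ ?_
  · intro π _
    have hv : ∀ t, t ≠ i + 1 →
        vert x (π * swap ⟨i, by omega⟩ ⟨i + 1, hi⟩) t = vert x π t := by
      intro t ht
      funext j
      have hs : (π * swap (⟨i, by omega⟩ : Fin n) ⟨i + 1, hi⟩).symm j =
          swap (⟨i, by omega⟩ : Fin n) ⟨i + 1, hi⟩ (π.symm j) := by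
        rw [Equiv.symm_apply_eq]; simp
      simp only [vert, hs]
      congr 1
      generalize π.symm j = a
      rw [swap_apply_def]
      split_ifs with h1 h2 h3 h4 h5 h6 <;> simp_all <;> omega
    have : skip (i + 1) (vert x (π * swap ⟨i, by omega⟩ ⟨i + 1, hi⟩)) =
        skip (i + 1) (vert x π) := by
      funext t
      unfold skip
      split_ifs with ht
      · exact hv t (by omega)
      · exact hv (t + 1) (by omega)
    rw [this, CharTwo.add_self_eq_zero]
  · intro π _ _ he
    exact hne (swap_eq_one_iff.mp (mul_eq_left.mp he))
  · intros; exact mem_univ _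
  · intro π _; simp [mul_assoc]

/-- The facet opposite the first vertex is also the facet opposite the last vertex of a simplex in
the next cube, with the directions rotated cyclically. -/
lemma vert_succ (x : Fin (n + 1) → ℕ) (π : Perm (Fin (n + 1))) {t : ℕ} (ht : t ≤ n) :
    vert x π (t + 1) =
      vert (fun j => x j + if j = π 0 then 1 else 0) (π * finRotate (n + 1)) t := by
  funext j
  obtain ⟨a, rfl⟩ := π.surjective j
  obtain ⟨b, rfl⟩ := (finRotate (n + 1)).surjective a
  have hs : (π * finRotate (n + 1)).symm (π (finRotate (n + 1) b)) = b := by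
    rw [Equiv.symm_apply_eq]; simp
  simp only [vert, hs, Equiv.symm_apply_apply, π.injective.eq_iff]
  rcases eq_or_ne b (Fin.last n) with rfl | hb
  · simp [ht]
  · have hb' := Fin.val_ne_of_ne hb
    have := coe_finRotate_of_ne_last hb
    have h0 : finRotate (n + 1) b ≠ 0 := by
      intro h
      rw [h] at this
      simp at this
    rw [if_neg h0, this]
    simp

/-- The shift agrees with a cyclic rotation of the `j`-th coordinate except at the wraparound, where
both terms vanish. -/
lemma sum_shift (H : (Fin n → ℕ) → ZMod 2) (j : Fin n)
    (hH : ∀ x, x j = 0 ∨ x j = M + 1 → H x = 0) :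
    ∑ x : Fin n → Fin (M + 1), H (fun i => x i + if i = j then 1 else 0) =
      ∑ x : Fin n → Fin (M + 1), H (fun i => x i) := by
  let e : (Fin n → Fin (M + 1)) ≃ (Fin n → Fin (M + 1)) :=
    Equiv.piCongrRight fun i => if i = j then finRotate (M + 1) else Equiv.refl _
  rw [← e.sum_comp (fun x => H (fun i => x i))]
  refine sum_congr rfl fun x _ => ?_
  have hj : e x j = finRotate (M + 1) (x j) := by simp [e]
  rcases eq_or_ne (x j) (Fin.last M) with hx | hx
  · rw [hH _ (Or.inr (by simp [hx])), hH _ (Or.inl (by simp [hj, hx]))]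
  · congr 1
    funext i
    by_cases hi : i = j
    · subst hi
      rw [hj, coe_finRotate_of_ne_last hx]; simp
    · simp [e, hi]

/-- Mod 2 Stokes theorem: a function of facets that vanishes on the boundary of the grid sums to
zero over the facets of all simplices. -/
lemma sum_sum_skip_eq_zero (h : (ℕ → Fin (n + 1) → ℕ) → ZMod 2)
    (hloc : ∀ v w : ℕ → Fin (n + 1) → ℕ, (∀ t ≤ n, v t = w t) → h v = h w)
    (hbd : ∀ x π, x (π (Fin.last n)) = 0 ∨ x (π (Fin.last n)) = M + 1 → h (vert x π) = 0) :
    ∑ x : Fin (n + 1) → Fin (M + 1), ∑ π : Perm (Fin (n + 1)), ∑ i ∈ range (n + 2),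
      h (skip i (vert (fun j => x j) π)) = 0 := by
  have hx : ∀ x : Fin (n + 1) → Fin (M + 1), ∑ π : Perm (Fin (n + 1)), ∑ i ∈ range (n + 2),
      h (skip i (vert (fun j => x j) π)) =
      ∑ π : Perm (Fin (n + 1)),
        h (vert (fun j => x j + if j = π (Fin.last n) then 1 else 0) π) +
      ∑ π : Perm (Fin (n + 1)), h (vert (fun j => x j) π) := by
    intro x
    rw [sum_comm, sum_range_succ, sum_range_succ', sum_eq_zero, zero_add]
    · congr 1
      · rw [← Equiv.sum_comp (Equiv.mulRight (finRotate (n + 1)))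
          (fun π => h (vert (fun j => x j + if j = π (Fin.last n) then 1 else 0) π))]
        refine sum_congr rfl fun π _ => hloc _ _ fun t ht => ?_
        rw [skip_of_le _ (Nat.zero_le _), vert_succ _ _ ht, coe_mulRight, Perm.mul_apply,
          finRotate_last]
      · exact sum_congr rfl fun π _ => hloc _ _ fun t ht => skip_of_lt _ (by omega)
    · intro i hi
      exact sum_skip_interior h _ (by simpa using hi)
  rw [sum_congr rfl fun x _ => hx x, sum_add_distrib, sum_comm, sum_comm (s := univ) (t := univ)
    (f := fun (x : Fin (n + 1) → Fin (M + 1)) (π : Perm (Fin (n + 1))) => h (vert (fun j => x j) π)),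
    sum_congr rfl fun π _ => sum_shift (fun x => h (vert x π)) (π (Fin.last n))
      (fun x => hbd x π), CharTwo.add_self_eq_zero]

end Stokes

/-! ### Invariance of the total cup product -/

/-- The total cup product of `l 0, …, l n` over the grid of side `M + 1`. -/
def total (n M : ℕ) (l : ℕ → (Fin (n + 1) → ℕ) → ZMod 2) : ZMod 2 :=
  ∑ x : Fin (n + 1) → Fin (M + 1), ∑ π : Perm (Fin (n + 1)),
    cup l (n + 1) (vert (fun j => x j) π)

/-- The label `l j` separates the two faces of the grid orthogonal to the `j`-th axis. -/
def Separates (n M : ℕ) (l : ℕ → (Fin (n + 1) → ℕ) → ZMod 2) : Prop :=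
  ∀ (j : Fin (n + 1)) x, (x j = 0 → l j x = 0) ∧ (x j = M + 1 → l j x = 1)

section Total

variable {n M : ℕ} {l l' : ℕ → (Fin (n + 1) → ℕ) → ZMod 2}

lemma vert_last (x : Fin (n + 1) → ℕ) (π : Perm (Fin (n + 1))) {t : ℕ} (ht : t ≤ n) :
    vert x π t (π (Fin.last n)) = x (π (Fin.last n)) := by
  simp [vert, ht]

/-- By Stokes only boundary facets matter. On a face orthogonal to axis `j ≠ k` the coboundary of `l
j` vanishes; for `j = k` the bare factor `l k` does. -/
lemma total_eq_zero {k : ℕ} (hk : k ≤ n)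
    (hconst : ∀ (j : Fin (n + 1)) x y, (j : ℕ) ≠ k → x j = y j → x j = 0 ∨ x j = M + 1 →
      l j x = l j y)
    (hzero : ∀ (j : Fin (n + 1)) x, (j : ℕ) = k → x j = 0 ∨ x j = M + 1 → l j x = 0) :
    total n M l = 0 := by
  obtain ⟨r, rfl⟩ := Nat.exists_eq_add_of_le hk
  unfold total
  simp only [← sum_primitive_skip]
  refine sum_sum_skip_eq_zero _ (fun v w h => primitive_congr l h) fun x π hx => ?_
  have hv := fun t (ht : t ≤ k + r) => vert_last x π ht
  revert hv hx
  generalize π (Fin.last (k + r)) = j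
  intro hx hv
  have hc : ∀ s t, s ≤ k + r → t ≤ k + r → (j : ℕ) ≠ k →
      l j (vert x π s) + l j (vert x π t) = 0 := fun s t hs ht hj => by
    rw [hconst j _ (vert x π t) hj (by rw [hv s hs, hv t ht]) (by rwa [hv s hs]),
      CharTwo.add_self_eq_zero]
  have hjn := j.isLt
  unfold primitive
  rcases lt_trichotomy (j : ℕ) k with hj | hj | hj
  · rw [cup, prod_eq_zero (mem_range.mpr hj) (hc _ _ (by omega) (by omega) hj.ne), zero_mul,
      zero_mul]
  · have := hzero j (vert x π k) hj (by rwa [hv _ (by omega)])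
    rw [hj] at this
    rw [this, mul_zero, zero_mul]
  · obtain ⟨s, hs⟩ := Nat.exists_eq_add_of_le (show k + 1 ≤ j by omega)
    rw [prod_eq_zero (i := s) (mem_range.mpr (by omega)), mul_zero]
    rw [← hs]
    exact hc _ _ (by omega) (by omega) hj.ne'

lemma cup_add {X : Type*} {l l' l'' : ℕ → X → ZMod 2} {k n : ℕ} (hk : k < n)
    (h : ∀ j, j ≠ k → l' j = l j) (h' : ∀ j, j ≠ k → l'' j = l j) (hadd : l'' k = l k + l' k)
    (w : ℕ → X) : cup l'' n w = cup l n w + cup l' n w := by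
  have hm := mem_range.mpr hk
  unfold cup
  rw [← mul_prod_erase _ _ hm, ← mul_prod_erase _ _ hm, ← mul_prod_erase _ _ hm,
    prod_congr rfl fun j hj => by rw [h' j (ne_of_mem_erase hj)],
    prod_congr (g := fun j => l j (w (j + 1)) + l j (w j)) (f := fun j => l' j (w (j + 1)) + l' j (w j)) rfl
      fun j hj => by rw [h j (ne_of_mem_erase hj)], hadd]
  simp only [Pi.add_apply]
  ring

/-- The total is additive in the `k`-th label, and `l k + l' k` is zero on both faces orthogonal to
axis `k`. -/
lemma total_eq_of_separates {k : ℕ} (hk : k ≤ n) (hl : Separates n M l) (hl' : Separates n M l')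
    (h : ∀ j, j ≠ k → l' j = l j) : total n M l = total n M l' := by
  have hz : total n M (Function.update l k (l k + l' k)) = 0 := by
    refine total_eq_zero hk ?_ ?_
    · intro j x y hj hxy hx
      rw [Function.update_of_ne hj]
      rcases hx with hx | hx
      · rw [(hl j x).1 hx, (hl j y).1 (hxy ▸ hx)]
      · rw [(hl j x).2 hx, (hl j y).2 (hxy ▸ hx)]
    · rintro j x rfl hx
      rw [Function.update_self, Pi.add_apply]
      rcases hx with hx | hx
      · rw [(hl j x).1 hx, (hl' j x).1 hx, add_zero]
      · rw [(hl j x).2 hx, (hl' j x).2 hx, CharTwo.add_self_eq_zero]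
  rw [← CharTwo.add_eq_zero, ← hz]
  unfold total
  rw [← sum_add_distrib]
  refine sum_congr rfl fun x _ => ?_
  rw [← sum_add_distrib]
  refine sum_congr rfl fun π _ => (cup_add (Nat.lt_succ_of_le hk) h ?_ ?_ _).symm
  · intro j hj; rw [Function.update_of_ne hj]
  · rw [Function.update_self]

/-- The labelling by the indicator of `x j ≠ 0`. -/
def stdLabel (n j : ℕ) (x : Fin (n + 1) → ℕ) : ZMod 2 :=
  if h : j < n + 1 then if x ⟨j, h⟩ = 0 then 0 else 1 else 0

lemma separates_stdLabel : Separates n M (stdLabel n) := fun j x => by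
  constructor <;> intro h <;> simp [stdLabel, j.isLt, h, -Order.lt_add_one_iff]

/-- Label `j` changes between vertices `j` and `j + 1` only if `x j = 0` and the `j`-th step goes
along axis `j`; this singles out one simplex. -/
lemma total_stdLabel : total n M (stdLabel n) = 1 := by
  have key : ∀ (x : Fin (n + 1) → Fin (M + 1)) (π : Perm (Fin (n + 1))),
      cup (stdLabel n) (n + 1) (vert (fun j => x j) π) ≠ 0 → x = 0 ∧ π = 1 := by
    intro x π h
    have h' : ∀ j : Fin (n + 1), (x j : ℕ) = 0 ∧ π.symm j = j := by
      intro j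
      have := prod_ne_zero_iff.mp h j (mem_range.mpr j.isLt)
      simp only [stdLabel, j.isLt, dite_true, vert, Fin.eta] at this
      by_contra hc
      apply this
      by_cases hx : (x j : ℕ) = 0
      · have hne : (π.symm j : ℕ) ≠ j := fun he => hc ⟨hx, Fin.ext he⟩
        rcases lt_or_gt_of_ne hne with hlt | hlt
        · simp [hlt, hlt.trans (Nat.lt_succ_self _)]; decide
        · simp [hx, not_lt.mpr hlt.le, show ¬ (π.symm j : ℕ) < j + 1 by omega]
      · have hx' : x j ≠ 0 := fun h => hx (by simp [h])
        simp [hx']; decide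
    refine ⟨funext fun j => Fin.ext (h' j).1, Equiv.ext fun j => ?_⟩
    have := (h' j).2
    rw [Equiv.symm_apply_eq] at this
    simpa using this.symm
  unfold total
  rw [sum_eq_single 0, sum_eq_single 1]
  · refine prod_eq_one fun j hj => ?_
    have h1 : ∀ a, (1 : Perm (Fin (n + 1))).symm a = a := fun _ => rfl
    simp [stdLabel, vert, mem_range.mp hj, h1, -Order.lt_add_one_iff]
  · intro π _ hπ
    by_contra h
    exact hπ (key _ _ h).2
  · simp
  · intro x _ hx
    refine sum_eq_zero fun π _ => ?_
    by_contra h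
    exact hx (key _ _ h).1
  · simp

lemma total_eq_one (hl : Separates n M l) : total n M l = 1 := by
  have key : ∀ k ≤ n + 1, total n M (fun j => if j < k then stdLabel n j else l j) =
      total n M l := by
    intro k
    induction k with
    | zero => simp
    | succ k ih =>
      intro hk
      rw [← ih (by omega)]
      have hsep : ∀ k, Separates n M (fun j => if j < k then stdLabel n j else l j) := by
        intro k j x
        by_cases hj : (j : ℕ) < k
        · simpa [hj] using separates_stdLabel j x
        · simpa [hj] using hl j x
      refine total_eq_of_separates (k := k) (by omega) (hsep _) (hsep _) fun j hj => ?_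
      have : j < k + 1 ↔ j < k := by omega
      simp only [this]
  rw [← key (n + 1) le_rfl, ← total_stdLabel (n := n) (M := M)]
  unfold total
  refine sum_congr rfl fun x _ => sum_congr rfl fun π _ => prod_congr rfl fun j hj => ?_
  simp only [mem_range.mp hj, if_true]

/-- The combinatorial Poincaré–Miranda theorem: some unit cube of the grid meets both values of
every label. -/
lemma exists_cube (hl : Separates n M l) :
    ∃ x : Fin (n + 1) → ℕ, (∀ i, x i ≤ M) ∧ ∀ j : Fin (n + 1), ∀ c : ZMod 2,
      ∃ y : Fin (n + 1) → ℕ, (∀ i, x i ≤ y i ∧ y i ≤ x i + 1) ∧ l j y = c := by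
  have h : total n M l ≠ 0 := by rw [total_eq_one hl]; exact one_ne_zero
  obtain ⟨x, _, hx⟩ := exists_ne_zero_of_sum_ne_zero h
  obtain ⟨π, _, hπ⟩ := exists_ne_zero_of_sum_ne_zero hx
  refine ⟨fun j => x j, fun i => Nat.lt_succ_iff.mp (x i).isLt, fun j c => ?_⟩
  -- A nonzero factor means that label `j` takes both values on the edge from vertex `j` to vertex
  -- `j + 1`.
  have hj := prod_ne_zero_iff.mp hπ j (mem_range.mpr j.isLt)
  have hb : ∀ t i, (x i : ℕ) ≤ vert (fun j => x j) π t i ∧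
      vert (fun j => x j) π t i ≤ (x i : ℕ) + 1 := by
    intro t i
    unfold vert
    split_ifs <;> simp
  by_cases hc : l j (vert (fun j => x j) π j) = c
  · exact ⟨_, hb _, hc⟩
  · refine ⟨_, hb (j + 1), ?_⟩
    revert hj hc
    generalize l j (vert (fun j => x j) π j) = a
    generalize l j (vert (fun j => x j) π (j + 1)) = b
    revert a b c
    decide

end Total

end GridCochain

/-! ### From the grid to a zero of the field -/

open Filter Topology in
/-- The Poincaré–Miranda theorem on a box in `Fin (n + 1) → ℝ`. -/
theorem exists_eq_zero_of_faces_fin {n : ℕ} {a b : Fin (n + 1) → ℝ} (hab : a ≤ b)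
    {f : (Fin (n + 1) → ℝ) → Fin (n + 1) → ℝ} (hf : ContinuousOn f (Set.Icc a b))
    (hlow : ∀ i, ∀ q ∈ Set.Icc a b, q i = a i → 0 ≤ f q i)
    (hup : ∀ i, ∀ q ∈ Set.Icc a b, q i = b i → f q i ≤ 0) :
    ∃ q ∈ Set.Icc a b, f q = 0 := by
  let p : ℕ → (Fin (n + 1) → ℕ) → Fin (n + 1) → ℝ := fun M x i =>
    a i + (x i : ℝ) / (M + 1) * (b i - a i)
  have hpmem : ∀ M x, (∀ i, x i ≤ M + 1) → p M x ∈ Set.Icc a b := by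
    intro M x hx
    have hx' : ∀ i, (x i : ℝ) / (M + 1) ≤ 1 := fun i => by
      rw [div_le_one (by positivity)]
      exact_mod_cast hx i
    refine ⟨fun i => ?_, fun i => ?_⟩
    · have := mul_nonneg (show 0 ≤ (x i : ℝ) / (M + 1) by positivity) (sub_nonneg.mpr (hab i))
      simp only [p]; linarith
    · have := mul_le_mul_of_nonneg_right (hx' i) (sub_nonneg.mpr (hab i))
      simp only [p]; linarith
  have hpup : ∀ M x i, x i = M + 1 → p M x i = b i := by
    intro M x i h
    have : ((M : ℝ) + 1) ≠ 0 := by positivity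
    simp [p, h, div_self this]
  have hplow : ∀ M x i, x i = 0 → p M x i = a i := by
    intro M x i h
    simp [p, h]
  have hcube : ∀ M : ℕ, ∃ u ∈ Set.Icc a b, ∀ j,
      (∃ v ∈ Set.Icc a b, dist v u ≤ dist b a / (M + 1) ∧ 0 ≤ f v j) ∧
      (∃ v ∈ Set.Icc a b, dist v u ≤ dist b a / (M + 1) ∧ f v j ≤ 0) := by
    intro M
    classical
    -- On the faces the label is forced by position, since `f` may vanish there; the face conditions
    -- still make label 0 mean `0 ≤ f` and label 1 mean `f ≤ 0`.
    let l : ℕ → (Fin (n + 1) → ℕ) → ZMod 2 := fun j x =>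
      if h : j < n + 1 then
        if x ⟨j, h⟩ = 0 ∨ (x ⟨j, h⟩ ≠ M + 1 ∧ 0 < f (p M x) ⟨j, h⟩) then 0 else 1
      else 0
    have hl : ∀ (j : Fin (n + 1)) x, l j x =
        if x j = 0 ∨ (x j ≠ M + 1 ∧ 0 < f (p M x) j) then 0 else 1 := fun j x => by
      simp only [l, j.isLt, dite_true, Fin.eta]
    have hsep : GridCochain.Separates n M l := fun j x => by
      rw [hl]
      constructor <;> intro h <;> simp [h]
    obtain ⟨x, hxM, hx⟩ := GridCochain.exists_cube hsep
    refine ⟨p M x, hpmem M x fun i => (hxM i).trans (Nat.le_succ M), fun j => ?_⟩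
    have hdist : ∀ y : Fin (n + 1) → ℕ, (∀ i, x i ≤ y i ∧ y i ≤ x i + 1) →
        dist (p M y) (p M x) ≤ dist b a / (M + 1) := by
      intro y hy
      refine (dist_pi_le_iff (by positivity)).mpr fun i => ?_
      have h1 : |(y i : ℝ) - x i| ≤ 1 := by
        have h1 : (x i : ℝ) ≤ y i := by exact_mod_cast (hy i).1
        have h2 : (y i : ℝ) ≤ x i + 1 := by exact_mod_cast (hy i).2
        rw [abs_le]; constructor <;> linarith
      have h2 := dist_le_pi_dist b a i
      rw [Real.dist_eq] at h2 ⊢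
      have h3 : p M y i - p M x i = ((y i : ℝ) - x i) * (b i - a i) / (M + 1) := by
        simp only [p]; ring
      rw [h3, abs_div, abs_mul, abs_of_pos (show (0 : ℝ) < M + 1 by positivity)]
      gcongr
      calc _ ≤ 1 * |b i - a i| := by gcongr
        _ ≤ _ := by rwa [one_mul]
    have hmem : ∀ y : Fin (n + 1) → ℕ, (∀ i, x i ≤ y i ∧ y i ≤ x i + 1) →
        p M y ∈ Set.Icc a b := fun y hy =>
      hpmem M y fun i => (hy i).2.trans (Nat.succ_le_succ (hxM i))
    constructor
    · obtain ⟨y, hy, hyl⟩ := hx j 0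
      refine ⟨p M y, hmem y hy, hdist y hy, ?_⟩
      rw [hl] at hyl
      split_ifs at hyl with h
      · rcases h with h | h
        · exact hlow j _ (hmem y hy) (hplow M y j h)
        · exact h.2.le
      · exact absurd hyl one_ne_zero
    · obtain ⟨y, hy, hyl⟩ := hx j 1
      refine ⟨p M y, hmem y hy, hdist y hy, ?_⟩
      rw [hl] at hyl
      split_ifs at hyl with h
      · exact absurd hyl zero_ne_one
      · push Not at h
        by_cases hj : y j = M + 1
        · exact hup j _ (hmem y hy) (hpup M y j hj)
        · exact h.2 hj
  choose u hu huf using hcube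
  obtain ⟨q, hq, φ, hφ, hlim⟩ := (isCompact_Icc (a := a) (b := b)).tendsto_subseq hu
  have hsmall : Tendsto (fun M : ℕ => dist b a / ((φ M : ℝ) + 1)) atTop (𝓝 0) :=
    (Tendsto.div_atTop tendsto_const_nhds
      (tendsto_atTop_add_const_right _ 1 tendsto_natCast_atTop_atTop)).comp hφ.tendsto_atTop
  have hclose : ∀ v : ℕ → Fin (n + 1) → ℝ, (∀ M, v M ∈ Set.Icc a b) →
      (∀ M, dist (v M) (u M) ≤ dist b a / (M + 1)) →
      Tendsto (fun M => f (v (φ M))) atTop (𝓝 (f q)) := by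
    intro v hv hvu
    refine (hf q hq).tendsto.comp (tendsto_nhdsWithin_iff.mpr ⟨?_, .of_forall fun M => hv _⟩)
    refine (tendsto_iff_of_dist ?_).mp hlim
    refine squeeze_zero (fun _ => dist_nonneg) (fun M => ?_) hsmall
    rw [dist_comm]
    exact hvu (φ M)
  -- Each component at `q` is a limit both of nonpositive and of nonnegative values.
  refine ⟨q, hq, funext fun j => le_antisymm ?_ ?_⟩
  · choose v hv hvu hvf using fun M => (huf M j).2
    exact le_of_tendsto ((tendsto_pi_nhds.mp (hclose v hv hvu)) j) (.of_forall fun M => hvf _)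
  · choose v hv hvu hvf using fun M => (huf M j).1
    exact ge_of_tendsto ((tendsto_pi_nhds.mp (hclose v hv hvu)) j) (.of_forall fun M => hvf _)

/-- The Poincaré–Miranda theorem: a continuous field on a box that points inwards on every face
has a zero. -/
theorem exists_eq_zero_of_faces {ι : Type*} [Fintype ι] {a b : ι → ℝ} (hab : a ≤ b)
    {f : (ι → ℝ) → ι → ℝ} (hf : ContinuousOn f (Set.Icc a b))
    (hlow : ∀ i, ∀ q ∈ Set.Icc a b, q i = a i → 0 ≤ f q i)
    (hup : ∀ i, ∀ q ∈ Set.Icc a b, q i = b i → f q i ≤ 0) :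
    ∃ q ∈ Set.Icc a b, f q = 0 := by
  rcases isEmpty_or_nonempty ι with hι | hι
  · exact ⟨a, ⟨le_rfl, hab⟩, Subsingleton.elim _ _⟩
  obtain ⟨n, hn⟩ := Nat.exists_eq_succ_of_ne_zero (Fintype.card_ne_zero (α := ι))
  let e : Fin (n + 1) ≃ ι := ((Fintype.equivFin ι).trans (finCongr hn)).symm
  have hmem : ∀ q ∈ Set.Icc (a ∘ e) (b ∘ e), q ∘ e.symm ∈ Set.Icc a b := fun q hq =>
    ⟨fun i => by simpa using hq.1 (e.symm i), fun i => by simpa using hq.2 (e.symm i)⟩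
  obtain ⟨q, hq, hfq⟩ := exists_eq_zero_of_faces_fin (a := a ∘ e) (b := b ∘ e)
    (f := fun q => f (q ∘ e.symm) ∘ e) (fun i => hab (e i))
    (by
      have h1 : ContinuousOn (fun q : Fin (n + 1) → ℝ => f (q ∘ e.symm))
          (Set.Icc (a ∘ e) (b ∘ e)) :=
        hf.comp (Continuous.continuousOn (by fun_prop)) hmem
      exact continuousOn_pi.mpr fun i => continuousOn_pi.mp h1 (e i))
    (fun i q hq hi => hlow (e i) _ (hmem q hq) (by simpa using hi))
    (fun i q hq hi => hup (e i) _ (hmem q hq) (by simpa using hi))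
  refine ⟨_, hmem q hq, funext fun i => ?_⟩
  simpa using congrFun hfq (e.symm i)

/-! ### Application to the queue dynamics -/

namespace BufferedNetwork

variable {V : Type*} {N : BufferedNetwork V}

lemma mem_queueRange_of_mem_Icc {i : V} {x y z : ℝ} (hx : x ∈ N.queueRange i)
    (hy : y ∈ N.queueRange i) (hz : z ∈ Set.Icc x y) : z ∈ N.queueRange i :=
  ⟨hx.1.trans hz.1, (ENNReal.ofReal_le_ofReal hz.2).trans hy.2⟩

lemma LocalPolicy.continuousOn_dynamics [Fintype V] (P : N.LocalPolicy) :
    ContinuousOn P.dynamics N.feasible := by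
  have hrate : ∀ i j, N.graph.Adj i j →
      ContinuousOn (fun q : V → ℝ => P.rate i j (q i) (q j)) N.feasible := fun i j hij =>
    (P.differentiableOn_rate i j hij).continuousOn.comp
      (f := fun q : V → ℝ => (q i, q j)) (Continuous.continuousOn (by fun_prop))
      fun q hq => ⟨hq i, hq j⟩
  classical
  refine continuousOn_pi.mpr fun i => ?_
  refine ((continuousOn_const.add ?_).sub ?_).sub ?_
  · exact continuousOn_finsetSum _ fun k hk => hrate k i (Finset.mem_filter.mp hk).2
  · exact continuousOn_finsetSum _ fun j hj => hrate i j (Finset.mem_filter.mp hj).2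
  · exact (P.differentiableOn_departure i).continuousOn.comp (f := fun q : V → ℝ => q i)
      (Continuous.continuousOn (by fun_prop)) fun q hq => hq i

end BufferedNetwork

theorem mainTheorem4 {V : Type*} [Fintype V] (N : BufferedNetwork V) (P : N.LocalPolicy)
    (bLow bUp : V → ℝ)
    (hle : ∀ i, bLow i ≤ bUp i)
    (hLow : bLow ∈ N.feasible) (hUp : bUp ∈ N.feasible)
    (hUpFace : ∀ (i : V) (q : V → ℝ), (∀ j, j ≠ i → q j ∈ Set.Icc (bLow j) (bUp j)) →
      q i = bUp i → P.dynamics q i ≤ 0)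
    (hLowFace : ∀ (i : V) (q : V → ℝ), (∀ j, j ≠ i → q j ∈ Set.Icc (bLow j) (bUp j)) →
      q i = bLow i → 0 ≤ P.dynamics q i) :
    ∃ q : V → ℝ, (∀ i, q i ∈ Set.Icc (bLow i) (bUp i)) ∧ P.IsEquilibrium q := by
  -- Each feasible range is order-convex, so feasible corners make the whole box feasible.
  have hbox : Set.Icc bLow bUp ⊆ N.feasible := fun q hq i =>
    BufferedNetwork.mem_queueRange_of_mem_Icc (hLow i) (hUp i) ⟨hq.1 i, hq.2 i⟩
  obtain ⟨q, hq, hzero⟩ := exists_eq_zero_of_faces hle (P.continuousOn_dynamics.mono hbox)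
    (fun i q hq => hLowFace i q fun j _ => ⟨hq.1 j, hq.2 j⟩)
    (fun i q hq => hUpFace i q fun j _ => ⟨hq.1 j, hq.2 j⟩)
  exact ⟨q, fun i => ⟨hq.1 i, hq.2 i⟩, hbox hq, hzero⟩
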